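/- Let $\Omega\subset\mathbb{R}^n$ be a smoothly bounded open set (for instance a domain; $\Omega$ need not be a bounded set): there is a $C^\infty$ function $r:\mathbb{R}^n\to\mathbb{R}$ with $\Omega=\{r<0\}$, $b\Omega=\{r=0\}$, where $b\Omega$ is the topological boundary of $\Omega$, and $\nabla r\neq 0$ in a neighborhood of $b\Omega$. Let $d(x)=\inf\{\|x-z\|: z\in b\Omega\}$ be the Euclidean distance to $b\Omega$, and let $\delta$ be the signed distance function, $\delta=-d$ on $\Omega$ and $\delta=d$ on $\mathbb{R}^n\setminus\Omega$. For a $C^\infty$ function $f$ write $H_f(\xi,\zeta)(x)=\sum_{j,k}\frac{\partial^2 f}{\partial x_j\partial x_k}(x)\,\xi_j\zeta_k$. Let $p\in b\Omega$ and let $U$ be an open neighborhood of $p$ such that $\delta$ is $C^\infty$ on $U$ and every $x\in U$ has a nearest boundary point in $U$, i.e. there is $b(x)\in b\Omega\cap U$ with $\|b(x)-x\|=|\delta(x)|$. Suppose that $\Omega$ is convex on $U$, that is, for some $C^\infty$ function $\rho$ on $U$ with $\Omega\cap U=\{x\in U:\rho(x)<0\}$ and $\nabla \rho\neq 0$ on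 $b\Omega\cap U$, $$H_\rho(\xi,\xi)(q)\ge 0\qquad\text{for all } q\in b\Omega\cap U \text{ and all } \xi\in\mathbb{R}^n \text{ with } \langle\nabla \rho(q),\xi\rangle=0 .$$ (This condition does not depend on the choice of $\rho$.) Then $\delta$ is convex on all of $U$, inside and outside $\Omega$, in the sense that $$H_\delta(\xi,\xi)(x)\ge 0\qquad\text{for all } x\in U \text{ and all } \xi\in\mathbb{R}^n .$$ -/

import Mathlib

open scoped ContDiff Topology

namespace ConvexDefining

/-- The Hessian `H_f(ξ, ζ)(x) = ∑ j k, (∂²f / ∂x_j ∂x_k)(x) ξ_j ζ_k`, as the second Fréchet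
derivative of `f` at `x` evaluated at the pair `(ξ, ζ)`. -/
noncomputable def hessian {n : ℕ} (f : EuclideanSpace ℝ (Fin n) → ℝ)
    (ξ ζ x : EuclideanSpace ℝ (Fin n)) : ℝ :=
  fderiv ℝ (fderiv ℝ f) x ξ ζ

/-- `Ω` is smoothly bounded: it has a global defining function `r` of class `C^∞`, with
`{r = 0} = bΩ`, whose gradient does not vanish in a neighbourhood of `bΩ`. The set `Ω` itself
need not be bounded. -/
def SmoothlyBounded {n : ℕ} (Ω : Set (EuclideanSpace ℝ (Fin n))) : Prop :=
  ∃ r : EuclideanSpace ℝ (Fin n) → ℝ,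
    ContDiff ℝ ∞ r ∧
    Ω = {x | r x < 0} ∧
    frontier Ω = {x | r x = 0} ∧
    ∀ᶠ x in 𝓝ˢ (frontier Ω), gradient r x ≠ 0

/-- `r` is a smooth local defining function for `Ω` on `U`, with non-vanishing gradient along the
boundary piece `U ∩ bΩ` (so that `r` determines the tangent spaces of `bΩ` there). -/
structure IsLocalDefiningFunction {n : ℕ} (Ω U : Set (EuclideanSpace ℝ (Fin n)))
    (r : EuclideanSpace ℝ (Fin n) → ℝ) : Prop where
  contDiffOn : ContDiffOn ℝ ∞ r U
  inter_eq : Ω ∩ U = {x ∈ U | r x < 0}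
  gradient_ne_zero : ∀ x ∈ U ∩ frontier Ω, gradient r x ≠ 0

/-- `Ω` is convex on the open set `U`: the Hessian of a local defining function `r` on `U` is
non-negative at the points `q` of `U ∩ bΩ` in the directions `ξ` tangent to `bΩ` at `q`, that is
`⟨∇r(q), ξ⟩ = 0`. (The condition does not depend on the choice of `r`.) -/
def SetConvexOn {n : ℕ} (Ω U : Set (EuclideanSpace ℝ (Fin n))) : Prop :=
  ∃ r : EuclideanSpace ℝ (Fin n) → ℝ, IsLocalDefiningFunction Ω U r ∧
    ∀ q ∈ U ∩ frontier Ω, ∀ ξ : EuclideanSpace ℝ (Fin n),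
      inner ℝ (gradient r q) ξ = 0 → 0 ≤ hessian r ξ ξ q

/-- A smooth function `f` on the open set `U` is convex on `U`: its Hessian is non-negative at
every point of `U` and in every direction. -/
def FunConvexOn {n : ℕ} (f : EuclideanSpace ℝ (Fin n) → ℝ)
    (U : Set (EuclideanSpace ℝ (Fin n))) : Prop :=
  ∀ x ∈ U, ∀ ξ : EuclideanSpace ℝ (Fin n), 0 ≤ hessian f ξ ξ x

open Classical in
/-- The signed distance to the boundary of `Ω`: minus the Euclidean distance to `bΩ` on `Ω`, and
plus that distance on the complement of `Ω`. -/
noncomputable def signedDist {n : ℕ} (Ω : Set (EuclideanSpace ℝ (Fin n)))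
    (x : EuclideanSpace ℝ (Fin n)) : ℝ :=
  if x ∈ Ω then -Metric.infDist x (frontier Ω) else Metric.infDist x (frontier Ω)

end ConvexDefining

open scoped ContDiff Topology

namespace ConvexDefining

/-! ### Calculus of gradients, Hessians and second-order conditions. -/

section Calculus

variable {F : Type*} [NormedAddCommGroup F] [InnerProductSpace ℝ F]

/-! Let `b` be a nearest boundary point of `x`, `s = δ(x)`, and `A`, `B` the Hessians of `δ` at `b`
and `x`. As `δ` is 1-Lipschitz it is affine on `[b, x]`, whence `b = P(x)` for `P(y) = y -
δ(y)∇δ(y)`, and `∇δ(b) = ∇δ(x)` (`nearest_point_eq`). Differentiating `∇δ ∘ P = ∇δ` gives `A(ξ -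
sBξ) = Bξ` (`fderiv_gradient_nearest_point`), while convexity of `Ω` gives `A ≥ 0`
(`SetConvexOn.hessian_signedDist_nonneg`).

Put `w = Bξ`. Positivity of `A` on `ξ - sw` says `⟨w, ξ⟩ ≥ s‖w‖²`, which settles `s ≥ 0`. Inside
`Ω`, positivity of `A` on `ξ` says `⟨w, ξ⟩ ≥ |s|(‖w‖² + s⟨Aw, w⟩)`, and the bracket is non-negative
because boundary curvatures at `b` are at most `1/|s|` (`second_order_bound`). Invertibility of `I +
sA` is never needed. -/

theorem two_le_infty : (2 : WithTop ℕ∞) ≤ ∞ :=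
  WithTop.coe_le_coe.2 (le_top : (2 : ℕ∞) ≤ ⊤)

/-- The second derivative is non-negative at a local minimum. -/
theorem nonneg_of_isLocalMin_of_hasDerivAt {f f' : ℝ → ℝ} {a c : ℝ} (hmin : IsLocalMin f a)
    (hf : ∀ᶠ t in 𝓝 a, HasDerivAt f (f' t) t) (hf' : HasDerivAt f' c a) : 0 ≤ c := by
  by_contra! hc
  have hd : deriv f =ᶠ[𝓝 a] f' := hf.mono fun t ht => ht.deriv
  have hdd : deriv (deriv f) a = c := hd.deriv_eq.trans hf'.deriv
  -- If `c < 0`, then `a` is also a local maximum, so `f` is locally constant and `c = 0`.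
  have hmax : IsLocalMax f a := isLocalMax_of_deriv_deriv_neg (hdd ▸ hc) hmin.deriv_eq_zero
    hf.self_of_nhds.continuousAt
  have hconst : f =ᶠ[𝓝 a] fun _ => f a := by
    filter_upwards [hmin, hmax] with t h₁ h₂ using le_antisymm h₂ h₁
  have hzero : deriv f =ᶠ[𝓝 a] fun _ => 0 := by
    simpa using hconst.deriv
  rw [hzero.deriv_eq, deriv_const] at hdd
  exact hc.ne hdd.symm

theorem eventually_pos_of_hasDerivAt {f : ℝ → ℝ} {a c : ℝ} (hf : HasDerivAt f c a) (hc : 0 < c)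
    (ha : f a = 0) : ∀ᶠ t in 𝓝[>] a, 0 < f t := by
  have h := (hasDerivWithinAt_iff_tendsto_slope' (s := Set.Ioi a) (by simp)).1
    hf.hasDerivWithinAt
  filter_upwards [h.eventually (lt_mem_nhds hc), self_mem_nhdsWithin] with t ht hta
  rw [slope_def_field, ha, sub_zero] at ht
  exact (div_pos_iff_of_pos_right (sub_pos.2 hta)).1 ht

theorem differentiableAt_of_contDiffOn {f : F → ℝ} {U : Set F} (hU : IsOpen U)
    (hf : ContDiffOn ℝ ∞ f U) {x : F} (hx : x ∈ U) : DifferentiableAt ℝ f x :=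
  (hf.contDiffAt (hU.mem_nhds hx)).differentiableAt (by simp)

/-- Equality case of Cauchy–Schwarz: expanding, `‖v - c • g‖² = c²(‖g‖² - 1) ≤ 0`. -/
theorem eq_smul_of_inner_eq {g v : F} {c : ℝ} (hg : ‖g‖ ≤ 1) (hv : ‖v‖ = |c|)
    (h : inner ℝ g v = c) : v = c • g := by
  have h₁ : ‖v - c • g‖ ^ 2 ≤ 0 := by
    rw [norm_sub_sq_real, inner_smul_right, real_inner_comm, h, norm_smul, hv, Real.norm_eq_abs,
      mul_pow, sq_abs]
    nlinarith [sq_nonneg c, mul_le_one₀ hg (norm_nonneg g) hg]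
  have h₂ : ‖v - c • g‖ = 0 := by nlinarith [norm_nonneg (v - c • g)]
  exact sub_eq_zero.1 (norm_eq_zero.1 h₂)

variable [CompleteSpace F]

theorem differentiableAt_gradient {f : F → ℝ} {U : Set F} (hU : IsOpen U)
    (hf : ContDiffOn ℝ ∞ f U) {x : F} (hx : x ∈ U) : DifferentiableAt ℝ (gradient f) x := by
  have h : DifferentiableAt ℝ (fderiv ℝ f) x :=
    ((hf.contDiffAt (hU.mem_nhds hx)).fderiv_right (m := 1)
      (one_add_one_eq_two.trans_le two_le_infty)).differentiableAt (by simp)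
  exact ((InnerProductSpace.toDual ℝ F).symm.toContinuousLinearEquiv.differentiableAt).comp x h

theorem inner_fderiv_gradient {f : F → ℝ} {U : Set F} (hU : IsOpen U)
    (hf : ContDiffOn ℝ ∞ f U) {x : F} (hx : x ∈ U) (ξ ζ : F) :
    inner ℝ (fderiv ℝ (gradient f) x ξ) ζ = fderiv ℝ (fderiv ℝ f) x ξ ζ := by
  have h : DifferentiableAt ℝ (fderiv ℝ f) x :=
    ((hf.contDiffAt (hU.mem_nhds hx)).fderiv_right (m := 1)
      (one_add_one_eq_two.trans_le two_le_infty)).differentiableAt (by simp)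
  have h₁ := (differentiableAt_gradient hU hf hx).hasFDerivAt.inner ℝ (hasFDerivAt_const ζ x)
  have h₂ : (fun y => inner ℝ (gradient f y) ζ) = fun y => fderiv ℝ f y ζ := by
    ext y; exact inner_gradient_left
  rw [h₂] at h₁
  have h₃ := h₁.unique (h.hasFDerivAt.clm_apply (hasFDerivAt_const ζ x))
  simpa using DFunLike.congr_fun h₃ ξ

theorem inner_fderiv_gradient_comm {f : F → ℝ} {U : Set F} (hU : IsOpen U)
    (hf : ContDiffOn ℝ ∞ f U) {x : F} (hx : x ∈ U) (ξ ζ : F) :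
    inner ℝ (fderiv ℝ (gradient f) x ξ) ζ = inner ℝ ξ (fderiv ℝ (gradient f) x ζ) := by
  rw [inner_fderiv_gradient hU hf hx, real_inner_comm, inner_fderiv_gradient hU hf hx]
  exact ((hf.contDiffAt (hU.mem_nhds hx)).isSymmSndFDerivAt
    (by rw [minSmoothness_of_isRCLikeNormedField]; exact two_le_infty)).eq ξ ζ

/-- If `f` is affine with slope `c` along the segment `[b, x]`, then the gradients of `f` at both
endpoints have inner product `c` with `x - b`. -/
theorem inner_gradient_of_affine_on_segment {f : F → ℝ} {x b : F} {c : ℝ}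
    (haff : ∀ t ∈ Set.Icc (0 : ℝ) 1, f (b + t • (x - b)) = t * c) {t : ℝ}
    (ht : t ∈ Set.Icc (0 : ℝ) 1) (hf : DifferentiableAt ℝ f (b + t • (x - b))) :
    inner ℝ (gradient f (b + t • (x - b))) (x - b) = c := by
  rw [inner_gradient_left]
  have hline : HasDerivAt (fun s : ℝ => b + s • (x - b)) (x - b) t := by
    simpa using ((hasDerivAt_id t).smul_const (x - b)).const_add b
  have h₁ : HasDerivWithinAt (fun s : ℝ => f (b + s • (x - b)))
      (fderiv ℝ f (b + t • (x - b)) (x - b)) (Set.Icc 0 1) t :=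
    (hf.hasFDerivAt.comp_hasDerivAt t hline).hasDerivWithinAt
  have h₂ : HasDerivWithinAt (fun s : ℝ => f (b + s • (x - b))) c (Set.Icc 0 1) t := by
    have := ((hasDerivAt_id t).mul_const c).hasDerivWithinAt (s := Set.Icc 0 1)
    rw [one_mul] at this
    exact this.congr haff (haff t ht)
  exact ((uniqueDiffOn_Icc_zero_one t ht).eq_deriv _ h₁ h₂)

theorem norm_gradient_le_one_of_lipschitz {f : F → ℝ} (hf : LipschitzWith 1 f) (x : F) :
    ‖gradient f x‖ ≤ 1 := by
  simpa [gradient] using norm_fderiv_le_of_lipschitz ℝ (x₀ := x) hf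

/-- The second-order condition at a point `b` where `f b = 0` and the inequality
`(f y - c)² ≤ ‖y - x‖²` is an equality. -/
theorem second_order_bound {f : F → ℝ} {U : Set F} (hU : IsOpen U) (hf : ContDiffOn ℝ ∞ f U)
    {x b : F} {c : ℝ} (hb : b ∈ U) (hle : ∀ y, (f y - c) ^ 2 ≤ ‖y - x‖ ^ 2)
    (hfb : f b = 0) (heq : ‖b - x‖ = |c|) (v : F) :
    -c * inner ℝ (fderiv ℝ (gradient f) b v) v ≤ ‖v‖ ^ 2 := by
  have hline : ∀ t, HasDerivAt (fun s : ℝ => b + s • v) v t := fun t => by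
    simpa using ((hasDerivAt_id t).smul_const v).const_add b
  have hmem : ∀ᶠ t : ℝ in 𝓝 0, b + t • v ∈ U :=
    (hline 0).continuousAt.eventually_mem (by simpa using hU.mem_nhds hb)
  have hf₁ : ∀ t : ℝ, b + t • v ∈ U → HasDerivAt (fun s : ℝ => f (b + s • v))
      (inner ℝ (gradient f (b + t • v)) v) t := fun t ht => by
    rw [inner_gradient_left]
    exact (differentiableAt_of_contDiffOn hU hf ht).hasFDerivAt.comp_hasDerivAt t (hline t)
  have hf₂ : HasDerivAt (fun t : ℝ => inner ℝ (gradient f (b + t • v)) v)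
      (inner ℝ (fderiv ℝ (gradient f) b v) v) 0 := by
    have hg : HasFDerivAt (gradient f) (fderiv ℝ (gradient f) b) (b + (0 : ℝ) • v) := by
      simpa using (differentiableAt_gradient hU hf hb).hasFDerivAt
    simpa using (hg.comp_hasDerivAt 0 (hline 0)).inner ℝ (hasDerivAt_const (0 : ℝ) v)
  have hmin : IsLocalMin (fun t : ℝ => ‖b + t • v - x‖ ^ 2 - (f (b + t • v) - c) ^ 2) 0 := by
    refine Filter.Eventually.of_forall fun t => ?_
    have := hle (b + t • v)
    simp [hfb, heq]
    linarith
  have hd₁ : ∀ᶠ t : ℝ in 𝓝 0,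
      HasDerivAt (fun t : ℝ => ‖b + t • v - x‖ ^ 2 - (f (b + t • v) - c) ^ 2)
      (2 * inner ℝ (b + t • v - x) v
        - 2 * ((f (b + t • v) - c) * inner ℝ (gradient f (b + t • v)) v)) t := by
    filter_upwards [hmem] with t ht
    refine (((hline t).sub_const x).norm_sq.sub
      (((hf₁ t ht).sub_const c).pow 2)).congr_deriv ?_
    push_cast
    ring
  have hfb' : f (b + (0 : ℝ) • v) = 0 := by simpa using hfb
  have hd₂ := ((((hline 0).sub_const x).inner ℝ (hasDerivAt_const (0 : ℝ) v)).const_mul 2).sub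
    ((((hf₁ 0 hmem.self_of_nhds).sub_const c).mul hf₂).const_mul 2)
  have h := nonneg_of_isLocalMin_of_hasDerivAt hmin hd₁ hd₂
  rw [hfb'] at h
  simp only [inner_zero_right, zero_add, real_inner_self_eq_norm_sq, zero_sub] at h
  -- The product rule also yields `⟨∇f(b), v⟩²`, whose sign allows it to be dropped.
  nlinarith [mul_self_nonneg (inner ℝ (gradient f (b + (0 : ℝ) • v)) v)]

end Calculus

/-! ### The signed distance: eikonal equation and nearest point map. -/

section SignedDistance

variable {n : ℕ} {Ω U : Set (EuclideanSpace ℝ (Fin n))}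

theorem exists_mem_segment_inter_frontier {x y : EuclideanSpace ℝ (Fin n)}
    (hx : x ∈ Ω) (hy : y ∉ Ω) : ∃ z ∈ segment ℝ x y, z ∈ frontier Ω := by
  have hpre : IsPreconnected (segment ℝ x y) := (convex_segment x y).isPreconnected
  by_contra! hz
  have hcover : segment ℝ x y ⊆ interior Ω ∪ (closure Ω)ᶜ := fun z hzs => by
    by_cases h : z ∈ interior Ω
    · exact Or.inl h
    · exact Or.inr fun hc => hz z hzs ⟨hc, h⟩
  have hx' : x ∈ interior Ω := (hcover (left_mem_segment ℝ x y)).resolve_right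
    fun h => h (subset_closure hx)
  have hy' : y ∈ (closure Ω)ᶜ := (hcover (right_mem_segment ℝ x y)).resolve_left
    fun h => hy (interior_subset h)
  obtain ⟨z, -, hz₁, hz₂⟩ := hpre _ _ isOpen_interior isClosed_closure.isOpen_compl hcover
    ⟨x, left_mem_segment ℝ x y, hx'⟩ ⟨y, right_mem_segment ℝ x y, hy'⟩
  exact hz₂ (interior_subset_closure hz₁)

theorem infDist_add_infDist_le {x y : EuclideanSpace ℝ (Fin n)} (hx : x ∈ Ω) (hy : y ∉ Ω) :
    Metric.infDist x (frontier Ω) + Metric.infDist y (frontier Ω) ≤ dist x y := by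
  obtain ⟨z, hzs, hz⟩ := exists_mem_segment_inter_frontier hx hy
  rw [← dist_add_dist_of_mem_segment hzs, dist_comm z y]
  exact add_le_add (Metric.infDist_le_dist_of_mem hz) (Metric.infDist_le_dist_of_mem hz)

/-- Only points on opposite sides of the boundary need an argument: the segment joining them meets
`bΩ`, so their distances to `bΩ` add up to at most `dist x y`. -/
theorem lipschitzWith_signedDist : LipschitzWith 1 (signedDist Ω) := by
  refine LipschitzWith.of_le_add fun x y => ?_
  have hxy := Metric.infDist_le_infDist_add_dist (s := frontier Ω) (x := x) (y := y)
  have hyx := Metric.infDist_le_infDist_add_dist (s := frontier Ω) (x := y) (y := x)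
  rw [dist_comm y x] at hyx
  have hx₀ : 0 ≤ Metric.infDist x (frontier Ω) := Metric.infDist_nonneg
  have hy₀ : 0 ≤ Metric.infDist y (frontier Ω) := Metric.infDist_nonneg
  have hd : 0 ≤ dist x y := dist_nonneg
  unfold signedDist
  split_ifs with hx hy hy
  · linarith
  · linarith
  · have := infDist_add_infDist_le hy hx
    rw [dist_comm y x] at this
    linarith
  · linarith

theorem abs_signedDist_sub_le (x y : EuclideanSpace ℝ (Fin n)) :
    |signedDist Ω x - signedDist Ω y| ≤ ‖x - y‖ := by
  simpa [Real.dist_eq, dist_eq_norm] using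
    (lipschitzWith_signedDist (Ω := Ω)).dist_le_mul x y

theorem signedDist_eq_zero_of_mem_frontier {x : EuclideanSpace ℝ (Fin n)}
    (hx : x ∈ frontier Ω) : signedDist Ω x = 0 := by
  unfold signedDist
  simp [Metric.infDist_zero_of_mem hx]

/-- The Lipschitz bounds from the two endpoints leave only one possible value. -/
theorem signedDist_of_mem_segment {x b : EuclideanSpace ℝ (Fin n)} (hb : b ∈ frontier Ω)
    (hbx : ‖b - x‖ = |signedDist Ω x|) (t : ℝ) (ht : t ∈ Set.Icc (0 : ℝ) 1) :
    signedDist Ω (b + t • (x - b)) = t * signedDist Ω x := by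
  have h₁ := abs_signedDist_sub_le (Ω := Ω) (b + t • (x - b)) b
  have h₂ := abs_signedDist_sub_le (Ω := Ω) (b + t • (x - b)) x
  have e₁ : ‖b + t • (x - b) - b‖ = t * |signedDist Ω x| := by
    rw [add_sub_cancel_left, norm_smul, Real.norm_of_nonneg ht.1, norm_sub_rev, hbx]
  have e₂ : ‖b + t • (x - b) - x‖ = (1 - t) * |signedDist Ω x| := by
    rw [show b + t • (x - b) - x = (1 - t) • (b - x) by module, norm_smul,
      Real.norm_of_nonneg (sub_nonneg.2 ht.2), hbx]
  rw [e₁, signedDist_eq_zero_of_mem_frontier hb, sub_zero, abs_le] at h₁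
  rw [e₂, abs_le] at h₂
  rcases abs_cases (signedDist Ω x) with ⟨h, -⟩ | ⟨h, -⟩ <;> rw [h] at h₁ h₂ <;>
    linarith [h₁.1, h₁.2, h₂.1, h₂.2]

/-- At a point with a nearest boundary point `b`, the nearest point map is
`x ↦ x - δ(x) ∇δ(x)`, and the gradients of `δ` at `x` and `b` agree. -/
theorem nearest_point_eq (hU : IsOpen U) (hsmooth : ContDiffOn ℝ ∞ (signedDist Ω) U)
    {x b : EuclideanSpace ℝ (Fin n)} (hx : x ∈ U) (hbU : b ∈ U) (hb : b ∈ frontier Ω)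
    (hbx : ‖b - x‖ = |signedDist Ω x|) :
    x - signedDist Ω x • gradient (signedDist Ω) x = b ∧
      gradient (signedDist Ω) b = gradient (signedDist Ω) x := by
  have haff := signedDist_of_mem_segment hb hbx
  have hnorm : ‖x - b‖ = |signedDist Ω x| := by rw [norm_sub_rev, hbx]
  have e₁ : b + (1 : ℝ) • (x - b) = x := by module
  have e₀ : b + (0 : ℝ) • (x - b) = b := by module
  have h₁ := inner_gradient_of_affine_on_segment haff (t := 1) (by simp)
    (by rw [e₁]; exact differentiableAt_of_contDiffOn hU hsmooth hx)
  have h₀ := inner_gradient_of_affine_on_segment haff (t := 0) (by simp)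
    (by rw [e₀]; exact differentiableAt_of_contDiffOn hU hsmooth hbU)
  rw [e₁] at h₁
  rw [e₀] at h₀
  have h₁' := eq_smul_of_inner_eq
    (norm_gradient_le_one_of_lipschitz lipschitzWith_signedDist x) hnorm h₁
  have h₀' := eq_smul_of_inner_eq
    (norm_gradient_le_one_of_lipschitz lipschitzWith_signedDist b) hnorm h₀
  refine ⟨by rw [← h₁']; abel, ?_⟩
  by_cases hδ : signedDist Ω x = 0
  · have : x = b := by simpa [hδ, sub_eq_zero] using h₁'
    rw [this]
  · exact smul_right_injective _ hδ (h₀'.symm.trans h₁')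

/-- Where `δ ≠ 0` this follows from `b = x - δ(x)∇δ(x)`. That argument is empty on `bΩ`, which is
reached by continuity from `Ω ∩ U`, where `δ` cannot vanish because `Ω` is open. -/
theorem norm_gradient_signedDist (hΩ : IsOpen Ω) (hU : IsOpen U)
    (hsmooth : ContDiffOn ℝ ∞ (signedDist Ω) U)
    (hnearest : ∀ x ∈ U, ∃ b ∈ U ∩ frontier Ω, ‖b - x‖ = |signedDist Ω x|)
    {x : EuclideanSpace ℝ (Fin n)} (hx : x ∈ U) : ‖gradient (signedDist Ω) x‖ = 1 := by
  have hne : ∀ y ∈ U, signedDist Ω y ≠ 0 → ‖gradient (signedDist Ω) y‖ = 1 := fun y hy hδ => by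
    obtain ⟨b, ⟨hbU, hb⟩, hbx⟩ := hnearest y hy
    have h := (nearest_point_eq hU hsmooth hy hbU hb hbx).1
    rw [← h, sub_sub_cancel_left, norm_neg, norm_smul, Real.norm_eq_abs] at hbx
    exact (mul_eq_left₀ (abs_ne_zero.2 hδ)).1 hbx
  by_cases hδ : signedDist Ω x = 0
  swap
  · exact hne x hx hδ
  obtain ⟨b, ⟨hbU, hb⟩, hbx⟩ := hnearest x hx
  obtain rfl : b = x := by simpa [hδ, sub_eq_zero] using hbx
  have hclosed : b ∈ closure (Ω ∩ U) := by
    rw [Set.inter_comm]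
    exact hU.inter_closure ⟨hbU, hb.1⟩
  have hcont : ContinuousAt (fun y => ‖gradient (signedDist Ω) y‖) b :=
    (differentiableAt_gradient hU hsmooth hbU).continuousAt.norm
  have hmem := hcont.continuousWithinAt.mem_closure hclosed (t := {1}) fun y hy => by
    refine hne y hy.2 fun h₀ => ?_
    obtain ⟨z, ⟨-, hz⟩, hzy⟩ := hnearest y hy.2
    obtain rfl : z = y := by simpa [h₀, sub_eq_zero] using hzy
    exact hz.2 (hΩ.interior_eq.symm ▸ hy.1)
  simpa using hmem

/-- Differentiate `‖∇δ‖² = 1` and use the symmetry of the Hessian. -/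
theorem fderiv_gradient_signedDist_apply_gradient (hΩ : IsOpen Ω) (hU : IsOpen U)
    (hsmooth : ContDiffOn ℝ ∞ (signedDist Ω) U)
    (hnearest : ∀ x ∈ U, ∃ b ∈ U ∩ frontier Ω, ‖b - x‖ = |signedDist Ω x|)
    {x : EuclideanSpace ℝ (Fin n)} (hx : x ∈ U) :
    fderiv ℝ (gradient (signedDist Ω)) x (gradient (signedDist Ω) x) = 0 := by
  have h₁ := (differentiableAt_gradient hU hsmooth hx).hasFDerivAt.norm_sq
  have h₂ : (fun y => ‖gradient (signedDist Ω) y‖ ^ 2) =ᶠ[𝓝 x] fun _ => 1 := by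
    filter_upwards [hU.mem_nhds hx] with y hy
    rw [norm_gradient_signedDist hΩ hU hsmooth hnearest hy, one_pow]
  have h₃ := (h₁.congr_of_eventuallyEq h₂.symm).unique (hasFDerivAt_const (1 : ℝ) x)
  refine ext_inner_right ℝ fun v => ?_
  have h₄ := DFunLike.congr_fun h₃ v
  rw [inner_fderiv_gradient_comm hU hsmooth hx, inner_zero_left]
  simpa using h₄

/-- The derivative of the nearest point map `y ↦ y - δ(y) ∇δ(y)`. -/
theorem hasFDerivAt_nearest_point (hU : IsOpen U) (hsmooth : ContDiffOn ℝ ∞ (signedDist Ω) U)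
    {x : EuclideanSpace ℝ (Fin n)} (hx : x ∈ U) :
    HasFDerivAt (fun y => y - signedDist Ω y • gradient (signedDist Ω) y)
      (ContinuousLinearMap.id ℝ _ - (signedDist Ω x • fderiv ℝ (gradient (signedDist Ω)) x +
        (fderiv ℝ (signedDist Ω) x).smulRight (gradient (signedDist Ω) x))) x :=
  (hasFDerivAt_id x).sub
    ((differentiableAt_of_contDiffOn hU hsmooth hx).hasFDerivAt.smul
      (differentiableAt_gradient hU hsmooth hx).hasFDerivAt)

/-- The Riccati-type relation between the Hessians of `δ` at `x` and at its nearest boundary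
point. -/
theorem fderiv_gradient_nearest_point (hΩ : IsOpen Ω) (hU : IsOpen U)
    (hsmooth : ContDiffOn ℝ ∞ (signedDist Ω) U)
    (hnearest : ∀ x ∈ U, ∃ b ∈ U ∩ frontier Ω, ‖b - x‖ = |signedDist Ω x|)
    {x b : EuclideanSpace ℝ (Fin n)} (hx : x ∈ U) (hbU : b ∈ U) (hb : b ∈ frontier Ω)
    (hbx : ‖b - x‖ = |signedDist Ω x|) (ξ : EuclideanSpace ℝ (Fin n)) :
    fderiv ℝ (gradient (signedDist Ω)) b
        (ξ - signedDist Ω x • fderiv ℝ (gradient (signedDist Ω)) x ξ) =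
      fderiv ℝ (gradient (signedDist Ω)) x ξ := by
  obtain ⟨hP, hG⟩ := nearest_point_eq hU hsmooth hx hbU hb hbx
  have h₁ : HasFDerivAt (gradient (signedDist Ω)) (fderiv ℝ (gradient (signedDist Ω)) b)
      (x - signedDist Ω x • gradient (signedDist Ω) x) := by
    rw [hP]; exact (differentiableAt_gradient hU hsmooth hbU).hasFDerivAt
  have h₂ := h₁.comp x (hasFDerivAt_nearest_point hU hsmooth hx)
  have h₃ : gradient (signedDist Ω) ∘
      (fun y => y - signedDist Ω y • gradient (signedDist Ω) y) =ᶠ[𝓝 x]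
      gradient (signedDist Ω) := by
    filter_upwards [hU.mem_nhds hx] with y hy
    obtain ⟨c, ⟨hcU, hc⟩, hcy⟩ := hnearest y hy
    obtain ⟨hPy, hGy⟩ := nearest_point_eq hU hsmooth hy hcU hc hcy
    simp only [Function.comp_apply, hPy, hGy]
  have h₄ := DFunLike.congr_fun ((h₂.congr_of_eventuallyEq h₃.symm).unique
    (differentiableAt_gradient hU hsmooth hx).hasFDerivAt) ξ
  -- The rank-one term of `P'(x)` has range along `∇δ(x) = ∇δ(b)`, which the Hessian at `b` kills.
  have h₅ := fderiv_gradient_signedDist_apply_gradient hΩ hU hsmooth hnearest hbU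
  rw [hG] at h₅
  simpa [h₅, sub_eq_add_neg] using h₄

end SignedDistance

/-! ### From an arbitrary defining function to `δ` along the boundary. -/

section Boundary

variable {n : ℕ} {Ω U : Set (EuclideanSpace ℝ (Fin n))}

theorem IsLocalDefiningFunction.eq_zero {r : EuclideanSpace ℝ (Fin n) → ℝ}
    (hr : IsLocalDefiningFunction Ω U r) (hΩ : IsOpen Ω) (hU : IsOpen U)
    {q : EuclideanSpace ℝ (Fin n)} (hqU : q ∈ U) (hq : q ∈ frontier Ω) : r q = 0 := by
  refine le_antisymm ?_ ?_
  · have hclosed : q ∈ closure (Ω ∩ U) := by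
      rw [Set.inter_comm]
      exact hU.inter_closure ⟨hqU, hq.1⟩
    have hcont := (differentiableAt_of_contDiffOn hU hr.contDiffOn hqU).continuousAt
    have h := hcont.continuousWithinAt.mem_closure hclosed (t := Set.Iic 0) fun y hy => by
      rw [hr.inter_eq] at hy
      exact hy.2.le
    simpa using h
  · by_contra! h
    have : q ∈ Ω ∩ U := by rw [hr.inter_eq]; exact ⟨hqU, h⟩
    exact hq.2 (hΩ.interior_eq.symm ▸ this.1)

/-- Along the boundary, the gradient of a defining function is a multiple of `∇δ`. -/
theorem IsLocalDefiningFunction.inner_gradient {r : EuclideanSpace ℝ (Fin n) → ℝ}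
    (hr : IsLocalDefiningFunction Ω U r) (hΩ : IsOpen Ω) (hU : IsOpen U)
    (hsmooth : ContDiffOn ℝ ∞ (signedDist Ω) U)
    (hnearest : ∀ x ∈ U, ∃ b ∈ U ∩ frontier Ω, ‖b - x‖ = |signedDist Ω x|)
    {q : EuclideanSpace ℝ (Fin n)} (hqU : q ∈ U) (hq : q ∈ frontier Ω)
    (ξ : EuclideanSpace ℝ (Fin n)) :
    inner ℝ (gradient r q) ξ = inner ℝ (gradient r q) (gradient (signedDist Ω) q) *
      inner ℝ (gradient (signedDist Ω) q) ξ := by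
  have hδ := signedDist_eq_zero_of_mem_frontier hq
  have h₁ : HasFDerivAt r (fderiv ℝ r q)
      (q - signedDist Ω q • gradient (signedDist Ω) q) := by
    rw [hδ, zero_smul, sub_zero]
    exact (differentiableAt_of_contDiffOn hU hr.contDiffOn hqU).hasFDerivAt
  have h₂ := h₁.comp q (hasFDerivAt_nearest_point hU hsmooth hqU)
  -- `P` maps `U` into `bΩ ∩ U`, where `r` vanishes; at `q`, `P'` is the projection along `∇δ(q)`.
  have h₃ : r ∘ (fun y => y - signedDist Ω y • gradient (signedDist Ω) y) =ᶠ[𝓝 q]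
      fun _ => 0 := by
    filter_upwards [hU.mem_nhds hqU] with y hy
    obtain ⟨c, ⟨hcU, hc⟩, hcy⟩ := hnearest y hy
    simp only [Function.comp_apply, (nearest_point_eq hU hsmooth hy hcU hc hcy).1,
      hr.eq_zero hΩ hU hcU hc]
  have h₄ := DFunLike.congr_fun ((h₂.congr_of_eventuallyEq h₃.symm).unique
    (hasFDerivAt_const (0 : ℝ) q)) ξ
  simp [hδ] at h₄
  rw [inner_gradient_left, inner_gradient_left, inner_gradient_left]
  linarith

/-- Moving from `q` along `-∇δ(q)` enters `Ω`, where `r < 0`, so the factor is not negative; it is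
not zero since `∇r(q) ≠ 0`. -/
theorem IsLocalDefiningFunction.inner_gradient_pos {r : EuclideanSpace ℝ (Fin n) → ℝ}
    (hr : IsLocalDefiningFunction Ω U r) (hΩ : IsOpen Ω) (hU : IsOpen U)
    (hsmooth : ContDiffOn ℝ ∞ (signedDist Ω) U)
    (hnearest : ∀ x ∈ U, ∃ b ∈ U ∩ frontier Ω, ‖b - x‖ = |signedDist Ω x|)
    {q : EuclideanSpace ℝ (Fin n)} (hqU : q ∈ U) (hq : q ∈ frontier Ω) :
    0 < inner ℝ (gradient r q) (gradient (signedDist Ω) q) := by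
  set G := gradient (signedDist Ω) q with hGdef
  refine lt_of_le_of_ne ?_ fun h₀ => ?_
  · by_contra! hneg
    have hline : HasDerivAt (fun s : ℝ => q + s • -G) (-G) 0 := by
      simpa using ((hasDerivAt_id (0 : ℝ)).smul_const (-G)).const_add q
    have hq₀ : q + (0 : ℝ) • -G = q := by simp
    have hδ' : HasDerivAt (fun s : ℝ => signedDist Ω (q + s • -G)) (-1) 0 := by
      have hd : HasFDerivAt (signedDist Ω) (fderiv ℝ (signedDist Ω) q) (q + (0 : ℝ) • -G) := by
        rw [hq₀]; exact (differentiableAt_of_contDiffOn hU hsmooth hqU).hasFDerivAt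
      have hv : fderiv ℝ (signedDist Ω) q (-G) = -1 := by
        rw [← inner_gradient_left, ← hGdef, inner_neg_right, real_inner_self_eq_norm_sq, hGdef,
          norm_gradient_signedDist hΩ hU hsmooth hnearest hqU, one_pow]
      rw [← hv]
      exact hd.comp_hasDerivAt 0 hline
    have hr' : HasDerivAt (fun s : ℝ => r (q + s • -G)) (-inner ℝ (gradient r q) G) 0 := by
      have hd : HasFDerivAt r (fderiv ℝ r q) (q + (0 : ℝ) • -G) := by
        rw [hq₀]; exact (differentiableAt_of_contDiffOn hU hr.contDiffOn hqU).hasFDerivAt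
      rw [← inner_neg_right, inner_gradient_left]
      exact hd.comp_hasDerivAt 0 hline
    have hmem : ∀ᶠ s : ℝ in 𝓝[>] 0, q + s • -G ∈ U :=
      (hline.continuousAt.eventually_mem (by simpa using hU.mem_nhds hqU)).filter_mono
        nhdsWithin_le_nhds
    have hrpos : ∀ᶠ s : ℝ in 𝓝[>] 0, 0 < r (q + s • -G) :=
      eventually_pos_of_hasDerivAt hr' (neg_pos.2 hneg)
        (by rw [hq₀, hr.eq_zero hΩ hU hqU hq])
    have hδneg : ∀ᶠ s : ℝ in 𝓝[>] 0, signedDist Ω (q + s • -G) < 0 := by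
      filter_upwards [eventually_pos_of_hasDerivAt hδ'.neg (by norm_num)
        (by simp [signedDist_eq_zero_of_mem_frontier hq])] with s hs using neg_pos.1 hs
    obtain ⟨s, hs₁, hs₂, hs₃⟩ := (hmem.and (hrpos.and hδneg)).exists
    have hsΩ : q + s • -G ∈ Ω := by
      by_contra hn
      rw [signedDist, if_neg hn] at hs₃
      exact hs₃.not_ge Metric.infDist_nonneg
    have : q + s • -G ∈ Ω ∩ U := ⟨hsΩ, hs₁⟩
    rw [hr.inter_eq] at this
    exact lt_asymm hs₂ this.2
  · refine hr.gradient_ne_zero q ⟨hqU, hq⟩ (inner_self_eq_zero (𝕜 := ℝ).1 ?_)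
    rw [hr.inner_gradient hΩ hU hsmooth hnearest hqU hq, ← hGdef, ← h₀, zero_mul]

/-- Near `q`, `∇r ∘ P = ⟨∇r ∘ P, ∇δ⟩ ∇δ`. Differentiating along a tangential `v` and pairing with
`v` gives `H_r(v, v) = ⟨∇r, ∇δ⟩ H_δ(v, v)` at `q`, with positive factor. The normal component of `ξ`
contributes nothing, as `∇δ` is in the kernel of the Hessian. -/
theorem SetConvexOn.hessian_signedDist_nonneg (hconv : SetConvexOn Ω U) (hΩ : IsOpen Ω)
    (hU : IsOpen U) (hsmooth : ContDiffOn ℝ ∞ (signedDist Ω) U)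
    (hnearest : ∀ x ∈ U, ∃ b ∈ U ∩ frontier Ω, ‖b - x‖ = |signedDist Ω x|)
    {q : EuclideanSpace ℝ (Fin n)} (hqU : q ∈ U) (hq : q ∈ frontier Ω)
    (ξ : EuclideanSpace ℝ (Fin n)) :
    0 ≤ inner ℝ (fderiv ℝ (gradient (signedDist Ω)) q ξ) ξ := by
  obtain ⟨r, hr, hrconv⟩ := hconv
  have hpos := hr.inner_gradient_pos hΩ hU hsmooth hnearest hqU hq
  have hpar := fun v => hr.inner_gradient hΩ hU hsmooth hnearest hqU hq v
  have hnorm := norm_gradient_signedDist hΩ hU hsmooth hnearest hqU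
  have hHG := fderiv_gradient_signedDist_apply_gradient hΩ hU hsmooth hnearest hqU
  have hδ := signedDist_eq_zero_of_mem_frontier hq
  have htan : ∀ v, inner ℝ (gradient (signedDist Ω) q) v = 0 →
      0 ≤ inner ℝ (fderiv ℝ (gradient (signedDist Ω)) q v) v := fun v hv => by
    have hP := hasFDerivAt_nearest_point hU hsmooth hqU
    have hR : HasFDerivAt (gradient r) (fderiv ℝ (gradient r) q)
        (q - signedDist Ω q • gradient (signedDist Ω) q) := by
      rw [hδ, zero_smul, sub_zero]
      exact (differentiableAt_gradient hU hr.contDiffOn hqU).hasFDerivAt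
    have hRP := hR.comp q hP
    have hG := (differentiableAt_gradient hU hsmooth hqU).hasFDerivAt
    have hv' : HasFDerivAt (fun _ => v) (0 : EuclideanSpace ℝ (Fin n) →L[ℝ] _) q :=
      hasFDerivAt_const v q
    have h₁ := hRP.inner ℝ hv'
    have h₂ := (hRP.inner ℝ hG).mul (hG.inner ℝ hv')
    have h₃ : (fun y => inner ℝ ((gradient r ∘
          fun y => y - signedDist Ω y • gradient (signedDist Ω) y) y) v) =ᶠ[𝓝 q]
        (fun y => inner ℝ ((gradient r ∘
          fun y => y - signedDist Ω y • gradient (signedDist Ω) y) y)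
            (gradient (signedDist Ω) y)) * fun y => inner ℝ (gradient (signedDist Ω) y) v := by
      filter_upwards [hU.mem_nhds hqU] with y hy
      obtain ⟨c, ⟨hcU, hc⟩, hcy⟩ := hnearest y hy
      obtain ⟨hPy, hGy⟩ := nearest_point_eq hU hsmooth hy hcU hc hcy
      simp only [Function.comp_apply, Pi.mul_apply, hPy]
      rw [← hGy]
      exact hr.inner_gradient hΩ hU hsmooth hnearest hcU hc v
    have h₄ := DFunLike.congr_fun ((h₂.congr_of_eventuallyEq h₃).unique h₁) v
    have hv₂ : fderiv ℝ (signedDist Ω) q v = 0 := by rw [← inner_gradient_left, hv]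
    simp [hδ, hv, hv₂] at h₄
    have h₅ := hrconv q ⟨hqU, hq⟩ v (by rw [hpar, hv, mul_zero])
    rw [hessian, ← inner_fderiv_gradient hU hr.contDiffOn hqU, ← h₄] at h₅
    rw [real_inner_comm, inner_gradient_left] at hpos
    exact nonneg_of_mul_nonneg_right h₅ hpos
  set G := gradient (signedDist Ω) q
  have h := htan (ξ - inner ℝ G ξ • G) (by
    rw [inner_sub_right, inner_smul_right, real_inner_self_eq_norm_sq, hnorm]; ring)
  rwa [map_sub, map_smul, hHG, smul_zero, sub_zero, inner_sub_right, inner_smul_right,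
    inner_fderiv_gradient_comm hU hsmooth hqU ξ G, hHG, inner_zero_right, mul_zero,
    sub_zero] at h

end Boundary

end ConvexDefining

/-! ### Comparison of the Hessians at `x` and at its nearest boundary point. -/

theorem corollaryC {n : ℕ} (Ω : Set (EuclideanSpace ℝ (Fin n))) (hΩ : IsOpen Ω)
    (hbdry : ConvexDefining.SmoothlyBounded Ω)
    (p : EuclideanSpace ℝ (Fin n)) (hp : p ∈ frontier Ω)
    (U : Set (EuclideanSpace ℝ (Fin n))) (hU : IsOpen U) (hpU : p ∈ U)
    (hsmooth : ContDiffOn ℝ ∞ (ConvexDefining.signedDist Ω) U)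
    (hnearest : ∀ x ∈ U, ∃ b ∈ U ∩ frontier Ω, ‖b - x‖ = |ConvexDefining.signedDist Ω x|)
    (hconv : ConvexDefining.SetConvexOn Ω U) :
    ConvexDefining.FunConvexOn (ConvexDefining.signedDist Ω) U := by
  intro x hx ξ
  obtain ⟨b, ⟨hbU, hb⟩, hbx⟩ := hnearest x hx
  have hA := hconv.hessian_signedDist_nonneg hΩ hU hsmooth hnearest hbU hb
  have hAB := ConvexDefining.fderiv_gradient_nearest_point hΩ hU hsmooth hnearest hx hbU hb hbx ξ
  have hbound := ConvexDefining.second_order_bound hU hsmooth (x := x)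
    (c := ConvexDefining.signedDist Ω x) hbU
    (fun y => sq_le_sq.2 (by simpa using ConvexDefining.abs_signedDist_sub_le y x))
    (ConvexDefining.signedDist_eq_zero_of_mem_frontier hb) hbx
    (fderiv ℝ (gradient (ConvexDefining.signedDist Ω)) x ξ)
  have hAsymm := ConvexDefining.inner_fderiv_gradient_comm hU hsmooth hbU
  rw [ConvexDefining.hessian, ← ConvexDefining.inner_fderiv_gradient hU hsmooth hx]
  set A := fderiv ℝ (gradient (ConvexDefining.signedDist Ω)) b
  set w := fderiv ℝ (gradient (ConvexDefining.signedDist Ω)) x ξ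
  set s := ConvexDefining.signedDist Ω x
  have hη := hA (ξ - s • w)
  have hξ := hA ξ
  have hw := hA w
  have hAξ : A ξ = w + s • A w := by
    rw [map_sub, map_smul] at hAB
    exact sub_eq_iff_eq_add.1 hAB
  have hwξ : inner ℝ (A w) ξ = ‖w‖ ^ 2 + s * inner ℝ (A w) w := by
    rw [hAsymm, hAξ, inner_add_right, inner_smul_right, real_inner_self_eq_norm_sq, hAsymm]
  rw [hAξ, inner_add_left, inner_smul_left, hwξ] at hξ
  rw [hAB, inner_sub_right, inner_smul_right, real_inner_self_eq_norm_sq] at hη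
  simp only [conj_trivial] at hξ
  rcases le_or_gt 0 s with hs | hs
  -- Outside `Ω` or on `bΩ`: `hη` suffices.
  · nlinarith [mul_nonneg hs (sq_nonneg ‖w‖)]
  -- Inside `Ω`: `hξ` together with `-s` times the curvature bound.
  · nlinarith [mul_le_mul_of_nonneg_left hbound (neg_nonneg.2 hs.le)]
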